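/- Let $d_A,d_B,d_C,d_D,d_E\ge 3$, let $|0\rangle_X,\dots,|d_X-1\rangle_X$ be the computational basis of $\mathbb{C}^{d_X}$, put $w_n=e^{2\pi\sqrt{-1}/n}$ and, for $X\in\{A,B,C,D,E\}$ and $s\in\{0,\dots,d_X-2\}$, put $$|\eta_s\rangle_X=\sum_{t=0}^{d_X-2}w_{d_X-1}^{st}|t\rangle_X,\qquad |\xi_s\rangle_X=\sum_{t=0}^{d_X-2}w_{d_X-1}^{st}|t+1\rangle_X .$$ Consider the following 32 sets of (unnormalised) product states in $\mathbb{C}^{d_A}\otimes\mathbb{C}^{d_B}\otimes\mathbb{C}^{d_C}\otimes\mathbb{C}^{d_D}\otimes\mathbb{C}^{d_E}$, where each index of an $\eta$ or $\xi$ in the tensor factor $X$ runs independently through $\{0,\dots,d_X-2\}$: $$\begin{aligned} &\mathcal{C}_{1}=\{|\xi_{i}\rangle_A|d_B-1\rangle_B|\eta_{j}\rangle_C|\xi_{k}\rangle_D|\eta_{\ell}\rangle_E\},\\ &\mathcal{C}_{2}=\{|\xi_{i}\rangle_A|\eta_{j}\rangle_B|0\rangle_C|\xi_{k}\rangle_D|\eta_{\ell}\rangle_E\},\\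 &\mathcal{C}_{3}=\{|\xi_{i}\rangle_A|\eta_{j}\rangle_B|\xi_{k}\rangle_C|d_D-1\rangle_D|\eta_{\ell}\rangle_E\},\\ &\mathcal{C}_{4}=\{|\xi_{i}\rangle_A|\eta_{j}\rangle_B|\xi_{k}\rangle_C|\eta_{\ell}\rangle_D|0\rangle_E\},\\ &\mathcal{C}_{5}=\{|\xi_{i}\rangle_A|d_B-1\rangle_B|d_C-1\rangle_C|\eta_{j}\rangle_D|0\rangle_E\},\\ &\mathcal{C}_{6}=\{|\xi_{i}\rangle_A|d_B-1\rangle_B|\eta_{j}\rangle_C|0\rangle_D|0\rangle_E\},\\ &\mathcal{C}_{7}=\{|\xi_{i}\rangle_A|d_B-1\rangle_B|d_C-1\rangle_C|d_D-1\rangle_D|\eta_{j}\rangle_E\},\\ &\mathcal{C}_{8}=\{|\xi_{i}\rangle_A|\eta_{j}\rangle_B|0\rangle_C|0\rangle_D|0\rangle_E\},\\ &\mathcal{C}_{9}=\{|d_A-1\rangle_A|\eta_{i}\rangle_B|\xi_{j}\rangle_C|\eta_{k}\rangle_D|\xi_{\ell}\rangle_E\},\\ &\mathcal{C}_{10}=\{|d_A-1\rangle_A|d_B-1\rangle_B|d_C-1\rangle_C|d_D-1\rangle_D|d_E-1\rangle_E\},\\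 &\mathcal{C}_{11}=\{|d_A-1\rangle_A|\eta_{i}\rangle_B|\xi_{j}\rangle_C|d_D-1\rangle_D|d_E-1\rangle_E\},\\ &\mathcal{C}_{12}=\{|d_A-1\rangle_A|\eta_{i}\rangle_B|0\rangle_C|0\rangle_D|\xi_{j}\rangle_E\},\\ &\mathcal{C}_{13}=\{|d_A-1\rangle_A|\eta_{i}\rangle_B|0\rangle_C|\xi_{j}\rangle_D|d_E-1\rangle_E\},\\ &\mathcal{C}_{14}=\{|d_A-1\rangle_A|d_B-1\rangle_B|\eta_{i}\rangle_C|\xi_{j}\rangle_D|d_E-1\rangle_E\},\\ &\mathcal{C}_{15}=\{|d_A-1\rangle_A|d_B-1\rangle_B|\eta_{i}\rangle_C|0\rangle_D|\xi_{j}\rangle_E\},\\ &\mathcal{C}_{16}=\{|d_A-1\rangle_A|d_B-1\rangle_B|d_C-1\rangle_C|\eta_{i}\rangle_D|\xi_{j}\rangle_E\},\\ &\mathcal{D}_{1}=\{|\eta_{i}\rangle_A|0\rangle_B|\xi_{j}\rangle_C|\eta_{k}\rangle_D|\xi_{\ell}\rangle_E\},\\ &\mathcal{D}_{2}=\{|\eta_{i}\rangle_A|\xi_{j}\rangle_B|d_C-1\rangle_C|\eta_{k}\rangle_D|\xi_{\ell}\rangle_E\},\\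 &\mathcal{D}_{3}=\{|\eta_{i}\rangle_A|\xi_{j}\rangle_B|\eta_{k}\rangle_C|0\rangle_D|\xi_{\ell}\rangle_E\},\\ &\mathcal{D}_{4}=\{|\eta_{i}\rangle_A|\xi_{j}\rangle_B|\eta_{k}\rangle_C|\xi_{\ell}\rangle_D|d_E-1\rangle_E\},\\ &\mathcal{D}_{5}=\{|\eta_{i}\rangle_A|0\rangle_B|0\rangle_C|\xi_{j}\rangle_D|d_E-1\rangle_E\},\\ &\mathcal{D}_{6}=\{|\eta_{i}\rangle_A|0\rangle_B|\xi_{j}\rangle_C|d_D-1\rangle_D|d_E-1\rangle_E\},\\ &\mathcal{D}_{7}=\{|\eta_{i}\rangle_A|0\rangle_B|0\rangle_C|0\rangle_D|\xi_{j}\rangle_E\},\\ &\mathcal{D}_{8}=\{|\eta_{i}\rangle_A|\xi_{j}\rangle_B|d_C-1\rangle_C|d_D-1\rangle_D|d_E-1\rangle_E\},\\ &\mathcal{D}_{9}=\{|0\rangle_A|\xi_{i}\rangle_B|\eta_{j}\rangle_C|\xi_{k}\rangle_D|\eta_{\ell}\rangle_E\},\\ &\mathcal{D}_{10}=\{|0\rangle_A|0\rangle_B|0\rangle_C|0\rangle_D|0\rangle_E\},\\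 &\mathcal{D}_{11}=\{|0\rangle_A|\xi_{i}\rangle_B|\eta_{j}\rangle_C|0\rangle_D|0\rangle_E\},\\ &\mathcal{D}_{12}=\{|0\rangle_A|\xi_{i}\rangle_B|d_C-1\rangle_C|d_D-1\rangle_D|\eta_{j}\rangle_E\},\\ &\mathcal{D}_{13}=\{|0\rangle_A|\xi_{i}\rangle_B|d_C-1\rangle_C|\eta_{j}\rangle_D|0\rangle_E\},\\ &\mathcal{D}_{14}=\{|0\rangle_A|0\rangle_B|\xi_{i}\rangle_C|\eta_{j}\rangle_D|0\rangle_E\},\\ &\mathcal{D}_{15}=\{|0\rangle_A|0\rangle_B|\xi_{i}\rangle_C|d_D-1\rangle_D|\eta_{j}\rangle_E\},\\ &\mathcal{D}_{16}=\{|0\rangle_A|0\rangle_B|0\rangle_C|\xi_{i}\rangle_D|\eta_{j}\rangle_E\}. \end{aligned}$$ To each of these 32 sets associate the box of points of $\prod_X\{0,\dots,d_X-1\}$ obtained by replacing the factors $|0\rangle_X$, $|d_X-1\rangle_X$, $|\eta\rangle_X$, $|\xi\rangle_X$ by $\{0\}$, $\{d_X-1\}$, $\{0,\dots,d_X-2\}$,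 $\{1,\dots,d_X-1\}$, respectively. Then: (a) the 32 boxes are pairwise disjoint and their union is the outermost layer of the hypercube, i.e. the set of points that have some coordinate equal to $0$ or $d_X-1$; and each of the 32 sets of states spans the same subspace as the computational basis vectors in its box; (b) $\mathcal{U}=\bigcup_{i=1}^{16}(\mathcal{C}_i\cup\mathcal{D}_i)$ is an orthogonal product set, i.e. it consists of nonzero product states, any two different ones being orthogonal; (c) $\mathcal{U}$ is of the strongest nonlocality: for every nonempty proper subset $T$ of the five parties and every POVM $\{E_k=M_k^\dagger M_k\}$ on the joint system of the parties in $T$ such that, for each $k$, the states $(M_k\otimes\mathbb{I})|\psi\rangle$, $|\psi\rangle\in\mathcal{U}$, are mutually orthogonal, all $E_k$ are proportional to the identity; (d) hence $\mathcal{U}$ is strongly nonlocal: in every bipartition of the five parties it is locally irreducible, i.e. no finite (adaptive) sequence of orthogonality-preserving local measurements by the two sides can eliminate one or more states: every sequence of outcomes that has positive probability on one state of $\mathcal{U}$ has positive probability on all of them; (e) $|\mathcal{U}|=d_Ad_Bd_Cd_Dd_E-(d_A-2)(d_B-2)(d_C-2)(d_D-2)(d_E-2)$. -/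

import Mathlib

open scoped Matrix

noncomputable section

namespace Hypercube

section General

variable {ι : Type} [Fintype ι] [DecidableEq ι]

/-- Labels of the computational basis of `⨂ i, ℂ^(d i)`: the points of the hypercube
`∏ i, {0, …, d i - 1}`. -/
abbrev Idx (d : ι → ℕ) : Type := ∀ i, Fin (d i)

/-- Labels of the computational basis of the joint system of the parties in `T`. -/
abbrev SubIdx (d : ι → ℕ) (T : Finset ι) : Type := ∀ i : T, Fin (d i)

/-- (Unnormalised) pure states of `⨂ i, ℂ^(d i)`, by their coordinates in the computational
basis. The inner product is `⟨ψ|φ⟩ = star ψ ⬝ᵥ φ`. -/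
abbrev State (d : ι → ℕ) : Type := Idx d → ℂ

/-- The product state `⨂ i, |v i⟩`. -/
def productState {d : ι → ℕ} (v : ∀ i, Fin (d i) → ℂ) : State d := fun x => ∏ i, v i (x i)

/-- An orthogonal product set: nonzero product states, pairwise orthogonal. -/
def IsOrthogonalProductSet {d : ι → ℕ} (X : Set (State d)) : Prop :=
  (∀ ψ ∈ X, ψ ≠ 0 ∧ ∃ v : ∀ i, Fin (d i) → ℂ, ψ = productState v) ∧
    ∀ ψ ∈ X, ∀ φ ∈ X, ψ ≠ φ → star ψ ⬝ᵥ φ = 0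

/-- The operator `M ⊗ 𝟙` on the whole system, where `M` acts on the parties in `T` and the
identity acts on the other parties. -/
def localOp {d : ι → ℕ} (T : Finset ι) (M : Matrix (SubIdx d T) (SubIdx d T) ℂ) :
    Matrix (Idx d) (Idx d) ℂ :=
  fun x y => if ∀ i, i ∉ T → x i = y i then M (fun i => x i) (fun i => y i) else 0

/-- The measurement operators `M k` define a POVM, with elements `E k = (M k)ᴴ * M k`. -/
def IsMeasurement {m : Type} [Fintype m] [DecidableEq m] {n : ℕ}
    (M : Fin n → Matrix m m ℂ) : Prop :=
  ∑ k, (M k)ᴴ * M k = 1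

/-- A measurement is trivial if all its POVM elements are proportional to the identity. -/
def IsTrivialMeasurement {m : Type} [Fintype m] [DecidableEq m] {n : ℕ}
    (M : Fin n → Matrix m m ℂ) : Prop :=
  ∀ k, ∃ c : ℂ, (M k)ᴴ * M k = c • (1 : Matrix m m ℂ)

/-- The images under `A` of the different states of `X` are mutually orthogonal. -/
def OrthogonalImages {d : ι → ℕ} (X : Set (State d)) (A : Matrix (Idx d) (Idx d) ℂ) : Prop :=
  ∀ ψ ∈ X, ∀ φ ∈ X, ψ ≠ φ → star (A *ᵥ ψ) ⬝ᵥ (A *ᵥ φ) = 0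

/-- The strongest nonlocality: for each bipartition of the parties, each of the two sides can
only perform trivial orthogonality-preserving measurements. As `T` runs over all nonempty proper
subsets, it runs over both sides of all bipartitions. -/
def IsStrongestNonlocal {d : ι → ℕ} (X : Set (State d)) : Prop :=
  ∀ T : Finset ι, T.Nonempty → T ≠ Finset.univ →
    ∀ (n : ℕ) (M : Fin n → Matrix (SubIdx d T) (SubIdx d T) ℂ), IsMeasurement M →
      (∀ k, OrthogonalImages X (localOp T (M k))) → IsTrivialMeasurement M

/-- `Branch X S K`: starting from an unknown state of `X`, finitely many (adaptively chosen)
orthogonality-preserving local measurements, each one by one of the two sides `S` and `Sᶜ`, can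
lead through a sequence of outcomes whose measurement operators multiply to `K`. -/
inductive Branch {d : ι → ℕ} (X : Set (State d)) (S : Finset ι) :
    Matrix (Idx d) (Idx d) ℂ → Prop
  | start : Branch X S 1
  | step (K : Matrix (Idx d) (Idx d) ℂ) (T : Finset ι) (n : ℕ)
      (M : Fin n → Matrix (SubIdx d T) (SubIdx d T) ℂ) (k : Fin n) :
      Branch X S K → (T = S ∨ T = Sᶜ) → IsMeasurement M →
      (∀ j, OrthogonalImages X (localOp T (M j) * K)) → Branch X S (localOp T (M k) * K)

/-- Local irreducibility in the bipartition `S | Sᶜ`: no state of `X` is eliminated by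
orthogonality-preserving local measurements, that is, whatever outcomes occur with positive
probability on some state of `X` do so on all states of `X`. -/
def IsLocallyIrreducibleAcross {d : ι → ℕ} (X : Set (State d)) (S : Finset ι) : Prop :=
  ∀ K, Branch X S K → (∃ φ ∈ X, K *ᵥ φ ≠ 0) → ∀ ψ ∈ X, K *ᵥ ψ ≠ 0

/-- Strong nonlocality: local irreducibility in every bipartition. -/
def IsStronglyNonlocal {d : ι → ℕ} (X : Set (State d)) : Prop :=
  ∀ S : Finset ι, S.Nonempty → S ≠ Finset.univ → IsLocallyIrreducibleAcross X S

/-- The outermost layer of the hypercube `∏ i, {0, …, d i - 1}`. -/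
def outermostLayer (d : ι → ℕ) : Set (Idx d) :=
  {x | ∃ i, (x i : ℕ) = 0 ∨ (x i : ℕ) = d i - 1}

end General

/-- The computational basis vector `|j⟩` of `ℂ^d` (for `j < d`). -/
def ket (d j : ℕ) : Fin d → ℂ := fun t => if (t : ℕ) = j then 1 else 0

/-- The root of unity `w_n = exp (2 π √-1 / n)`. -/
def w (n : ℕ) : ℂ := Complex.exp (2 * Real.pi * Complex.I / n)

/-- `|η_s⟩ = ∑_{t=0}^{d-2} w_{d-1}^{s t} |t⟩`. -/
def eta (d s : ℕ) : Fin d → ℂ := ∑ t ∈ Finset.range (d - 1), w (d - 1) ^ (s * t) • ket d t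

/-- `|ξ_s⟩ = ∑_{t=0}^{d-2} w_{d-1}^{s t} |t+1⟩`. -/
def xi (d s : ℕ) : Fin d → ℂ := ∑ t ∈ Finset.range (d - 1), w (d - 1) ^ (s * t) • ket d (t + 1)

/-- The four kinds of tensor factors in the blocks: `|0⟩`, `|d-1⟩`, the `|η_s⟩`, the `|ξ_s⟩`. -/
inductive Side
  | zero
  | last
  | eta
  | xi

/-- The states of `ℂ^d` of a given kind. -/
def sideStates (d : ℕ) : Side → Set (Fin d → ℂ)
  | .zero => {ket d 0}
  | .last => {ket d (d - 1)}
  | .eta => {v | ∃ s, s < d - 1 ∧ v = eta d s}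
  | .xi => {v | ∃ s, s < d - 1 ∧ v = xi d s}

/-- The basis labels on which the states of a given kind are supported: `{0}`, `{d-1}`,
`{0, …, d-2}`, `{1, …, d-1}`. -/
def sideCell (d : ℕ) : Side → Set (Fin d)
  | .zero => {t | (t : ℕ) = 0}
  | .last => {t | (t : ℕ) = d - 1}
  | .eta => {t | (t : ℕ) < d - 1}
  | .xi => {t | 0 < (t : ℕ)}

/-- The blocks `C_1, …, C_16`; the columns are the parties `A, B, C, D, E`. -/
def blockC : Fin 16 → Fin 5 → Side := ![
  ![.xi, .last, .eta, .xi, .eta],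
  ![.xi, .eta, .zero, .xi, .eta],
  ![.xi, .eta, .xi, .last, .eta],
  ![.xi, .eta, .xi, .eta, .zero],
  ![.xi, .last, .last, .eta, .zero],
  ![.xi, .last, .eta, .zero, .zero],
  ![.xi, .last, .last, .last, .eta],
  ![.xi, .eta, .zero, .zero, .zero],
  ![.last, .eta, .xi, .eta, .xi],
  ![.last, .last, .last, .last, .last],
  ![.last, .eta, .xi, .last, .last],
  ![.last, .eta, .zero, .zero, .xi],
  ![.last, .eta, .zero, .xi, .last],
  ![.last, .last, .eta, .xi, .last],
  ![.last, .last, .eta, .zero, .xi],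
  ![.last, .last, .last, .eta, .xi]]

/-- The blocks `D_1, …, D_16`. -/
def blockD : Fin 16 → Fin 5 → Side := ![
  ![.eta, .zero, .xi, .eta, .xi],
  ![.eta, .xi, .last, .eta, .xi],
  ![.eta, .xi, .eta, .zero, .xi],
  ![.eta, .xi, .eta, .xi, .last],
  ![.eta, .zero, .zero, .xi, .last],
  ![.eta, .zero, .xi, .last, .last],
  ![.eta, .zero, .zero, .zero, .xi],
  ![.eta, .xi, .last, .last, .last],
  ![.zero, .xi, .eta, .xi, .eta],
  ![.zero, .zero, .zero, .zero, .zero],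
  ![.zero, .xi, .eta, .zero, .zero],
  ![.zero, .xi, .last, .last, .eta],
  ![.zero, .xi, .last, .eta, .zero],
  ![.zero, .zero, .xi, .eta, .zero],
  ![.zero, .zero, .xi, .last, .eta],
  ![.zero, .zero, .zero, .xi, .eta]]

/-- All 32 blocks. -/
def block : Fin 16 ⊕ Fin 16 → Fin 5 → Side := Sum.elim blockC blockD

/-- The set of product states that a block stands for: each tensor factor runs independently
through the states of its kind. -/
def blockStates (d : Fin 5 → ℕ) (b : Fin 5 → Side) : Set (State d) :=
  {ψ | ∃ v : ∀ i, Fin (d i) → ℂ, (∀ i, v i ∈ sideStates (d i) (b i)) ∧ ψ = productState v}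

/-- The box of hypercube points that a block stands for. -/
def blockBox (d : Fin 5 → ℕ) (b : Fin 5 → Side) : Set (Idx d) :=
  {x | ∀ i, x i ∈ sideCell (d i) (b i)}

/-- The union of the 32 blocks `C_i`, `D_i`. -/
def opsFive (d : Fin 5 → ℕ) : Set (State d) := ⋃ k, blockStates d (block k)

end Hypercube

end

/-!
The boxes of the 32 blocks tile the outermost layer of the hypercube, and the states of a block are
obtained from the basis vectors in its box by discrete Fourier transforms in the factors `η` and
`ξ`. So the states of a block are pairwise orthogonal, have the same span as its box, and have
coordinates of modulus one there; orthogonality of the whole set and the number of states (the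
dimension of its span) follow.

For the nonlocality, let `E = Mᴴ * M` for an orthogonality-preserving operator `M` on the parties in
`T`, let `i ∉ T`, and let `G = E ⊗ 𝟙`. Two facts determine `G`.

* Between points of different boxes `G` vanishes, as the states of a block span the basis vectors of
  its box (`apply_eq_zero_of_mem_blockBox`).
* Within a block, `G` is diagonal with respect to the Fourier basis, so that `G x y` depends only on
  the relative phases `ψ x * star (ψ y)` of the states of the block, that is, on the cyclic
  differences of the coordinates of `x` and `y` (`apply_eq_apply_of_phase_eq`). Hence the pair may
  be moved cyclically inside the block, such that in each coordinate either point, as preferred,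
  gets to the corner of the cell, and the other one stays off it where the pair differs
  (`exists_pos`).

Moreover `G x y` vanishes if `x` and `y` differ in the coordinate `i`, and otherwise does not
change when the coordinate `i` of both points is changed simultaneously. Alternating between moves
inside a block and moves in the direction `i`, any pair of different points arrives at a pair in
different boxes, so its entry is zero, and any pair `x = y` arrives in one fixed block, so all
diagonal entries agree. Only whether the coordinates are first, last or in between matters for
these moves, so that this is a finite search, independent of the dimensions: it is defined in
`reach`, carried out in `reach_eq_true` and proved sound in `apply_eq_ite_of_reach`. The result is
that `G`, and with it `E`, is a multiple of the identity (`exists_conjTranspose_mul_self_eq`).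

Local irreducibility follows by induction on the rounds of a protocol: the operators applied so far
by each of the two sides multiply to a multiple of an isometry (`Branch.exists_eq_mul`), so a branch
either never occurs or maps no state to zero.
-/

open scoped Matrix

noncomputable section

namespace Hypercube

/-! ### Orthogonal families of vectors -/

section Orthogonal

variable {m : Type} [Fintype m]

open scoped ComplexOrder in
lemma star_dotProduct_self_ne_zero {v : m → ℂ} (hv : v ≠ 0) : star v ⬝ᵥ v ≠ 0 :=
  mt dotProduct_star_self_eq_zero.mp hv

open scoped ComplexOrder in
lemma eq_zero_of_conjTranspose_mul_self_eq_zero {A : Matrix m m ℂ} (h : Aᴴ * A = 0) : A = 0 :=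
  Matrix.conjTranspose_mul_self_eq_zero.mp h

lemma linearIndepOn_of_orthogonal {S : Set (m → ℂ)} (h0 : ∀ v ∈ S, v ≠ 0)
    (ho : ∀ v ∈ S, ∀ u ∈ S, v ≠ u → star v ⬝ᵥ u = 0) : LinearIndepOn ℂ id S := by
  classical
  rw [LinearIndepOn, linearIndependent_iff']
  intro s g hg i hi
  have h := congrArg (fun u => star (i : m → ℂ) ⬝ᵥ u) hg
  simp only [id_eq, dotProduct_sum, dotProduct_smul, dotProduct_zero] at h
  rw [Finset.sum_eq_single i (fun j _ hj => by
    rw [ho i i.2 j j.2 (fun e => hj (Subtype.ext e.symm)), smul_zero])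
    (fun hn => absurd hi hn)] at h
  exact (smul_eq_zero.mp h).resolve_right (star_dotProduct_self_ne_zero (h0 i i.2))

/-- Fourier expansion with respect to a finite family of pairwise orthogonal vectors. -/
lemma eq_sum_of_mem_span {S : Finset (m → ℂ)} (h0 : ∀ v ∈ S, v ≠ 0)
    (ho : ∀ v ∈ S, ∀ u ∈ S, v ≠ u → star v ⬝ᵥ u = 0) {u : m → ℂ}
    (hu : u ∈ Submodule.span ℂ (S : Set (m → ℂ))) :
    u = ∑ v ∈ S, (star v ⬝ᵥ u / star v ⬝ᵥ v) • v := by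
  obtain ⟨c, -, rfl⟩ := Submodule.mem_span_finset.mp hu
  refine Finset.sum_congr rfl fun v hv => ?_
  rw [dotProduct_sum, Finset.sum_eq_single v]
  · rw [dotProduct_smul, smul_eq_mul, mul_div_cancel_right₀ _
      (star_dotProduct_self_ne_zero (h0 v hv))]
  · intro b hb hne
    rw [dotProduct_smul, ho v hv b hb hne.symm, smul_zero]
  · exact fun h => absurd hv h

lemma star_mulVec_dotProduct_mulVec (A : Matrix m m ℂ) (v u : m → ℂ) :
    star (A *ᵥ v) ⬝ᵥ (A *ᵥ u) = star v ⬝ᵥ ((Aᴴ * A) *ᵥ u) := by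
  rw [Matrix.star_mulVec, ← Matrix.mulVec_mulVec, Matrix.dotProduct_mulVec,
    Matrix.dotProduct_mulVec, Matrix.dotProduct_mulVec]

/-- A form that vanishes between two families vanishes between their spans. -/
lemma star_dotProduct_mulVec_eq_zero_of_mem_span {S S' : Set (m → ℂ)} {G : Matrix m m ℂ}
    (h : ∀ v ∈ S, ∀ u ∈ S', star v ⬝ᵥ (G *ᵥ u) = 0) {v u : m → ℂ}
    (hv : v ∈ Submodule.span ℂ S) (hu : u ∈ Submodule.span ℂ S') :
    star v ⬝ᵥ (G *ᵥ u) = 0 := by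
  induction hv, hu using Submodule.span_induction₂ with
  | mem_mem v u hv hu => exact h v hv u hu
  | zero_left u _ => simp
  | zero_right v _ => simp
  | add_left v v' u _ _ _ h1 h2 => rw [star_add, add_dotProduct, h1, h2, add_zero]
  | add_right v u u' _ _ _ h1 h2 => rw [Matrix.mulVec_add, dotProduct_add, h1, h2, add_zero]
  | smul_left c v u _ _ h1 => rw [star_smul, smul_dotProduct, h1, smul_zero]
  | smul_right c v u _ _ h1 => rw [Matrix.mulVec_smul, dotProduct_smul, h1, smul_zero]

variable [DecidableEq m]

lemma star_single_dotProduct_mulVec (G : Matrix m m ℂ) (x y : m) :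
    star (Pi.single x (1 : ℂ)) ⬝ᵥ (G *ᵥ Pi.single y 1) = G x y := by
  rw [← Pi.single_star, star_one, single_one_dotProduct, Matrix.mulVec_single_one, Matrix.col_apply]

/-- If a form is diagonal with respect to an orthogonal family, then its entry at a pair of basis
vectors in the span of the family depends only on the phases `v x * star (v y)`, since it equals
`∑ v, (star v ⬝ᵥ G *ᵥ v) / (star v ⬝ᵥ v) ^ 2 * (v x * star (v y))`. -/
lemma apply_eq_apply_of_phase_eq {S : Set (m → ℂ)} (h0 : ∀ v ∈ S, v ≠ 0)
    (ho : ∀ v ∈ S, ∀ u ∈ S, v ≠ u → star v ⬝ᵥ u = 0) {G : Matrix m m ℂ}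
    (hG : ∀ v ∈ S, ∀ u ∈ S, v ≠ u → star v ⬝ᵥ (G *ᵥ u) = 0) {x y x' y' : m}
    (hx : (Pi.single x 1 : m → ℂ) ∈ Submodule.span ℂ S)
    (hy : (Pi.single y 1 : m → ℂ) ∈ Submodule.span ℂ S)
    (hx' : (Pi.single x' 1 : m → ℂ) ∈ Submodule.span ℂ S)
    (hy' : (Pi.single y' 1 : m → ℂ) ∈ Submodule.span ℂ S)
    (h : ∀ v ∈ S, v x * star (v y) = v x' * star (v y')) : G x y = G x' y' := by
  have hfin : S.Finite := (linearIndepOn_of_orthogonal h0 ho).setFinite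
  lift S to Finset (m → ℂ) using hfin
  simp only [Finset.mem_coe] at h0 ho hG h
  have key : ∀ a b : m, (Pi.single a 1 : m → ℂ) ∈ Submodule.span ℂ (S : Set (m → ℂ)) →
      (Pi.single b 1 : m → ℂ) ∈ Submodule.span ℂ (S : Set (m → ℂ)) →
      G a b = ∑ v ∈ S, (v a * star (v b)) *
        (star v ⬝ᵥ (G *ᵥ v) / (star (star v ⬝ᵥ v) * (star v ⬝ᵥ v))) := by
    intro a b ha hb
    rw [← star_single_dotProduct_mulVec G a b]
    conv_lhs => rw [eq_sum_of_mem_span h0 ho ha, eq_sum_of_mem_span h0 ho hb]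
    rw [star_sum, sum_dotProduct]
    refine Finset.sum_congr rfl fun v hv => ?_
    rw [Matrix.mulVec_sum, dotProduct_sum, Finset.sum_eq_single v]
    · simp only [dotProduct_single_one, Pi.star_apply, star_smul, Matrix.mulVec_smul,
        smul_dotProduct, dotProduct_smul, smul_eq_mul, star_div₀, star_star]
      ring
    · intro u hu hne
      rw [star_smul, smul_dotProduct, Matrix.mulVec_smul, dotProduct_smul,
        hG v hv u hu hne.symm, smul_zero, smul_zero]
    · exact fun h => absurd hv h
  rw [key x y hx hy, key x' y' hx' hy']
  exact Finset.sum_congr rfl fun v hv => by rw [h v hv]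

end Orthogonal

/-! ### Local operators -/

section LocalOp

variable {ι : Type} [Fintype ι] [DecidableEq ι] {d : ι → ℕ}

lemma localOp_eq_submatrix (T : Finset ι) (M : Matrix (SubIdx d T) (SubIdx d T) ℂ) :
    localOp T M = (Matrix.kroneckerMap (· * ·) M
      (1 : Matrix (∀ i : {i // i ∉ T}, Fin (d i)) (∀ i : {i // i ∉ T}, Fin (d i)) ℂ)).submatrix
        (Equiv.piEquivPiSubtypeProd (· ∈ T) fun i => Fin (d i))
        (Equiv.piEquivPiSubtypeProd (· ∈ T) fun i => Fin (d i)) := by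
  ext x y
  simp only [localOp, Matrix.submatrix_apply, Equiv.piEquivPiSubtypeProd_apply,
    Matrix.kroneckerMap_apply, Matrix.one_apply, funext_iff, Subtype.forall, mul_ite, mul_one,
    mul_zero]

lemma localOp_mul (T : Finset ι) (M N : Matrix (SubIdx d T) (SubIdx d T) ℂ) :
    localOp T (M * N) = localOp T M * localOp T N := by
  simp only [localOp_eq_submatrix]
  rw [Matrix.submatrix_mul_equiv, ← Matrix.mul_kronecker_mul, mul_one]

lemma localOp_conjTranspose (T : Finset ι) (M : Matrix (SubIdx d T) (SubIdx d T) ℂ) :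
    localOp T Mᴴ = (localOp T M)ᴴ := by
  simp only [localOp_eq_submatrix]
  rw [Matrix.conjTranspose_submatrix, Matrix.conjTranspose_kronecker, Matrix.conjTranspose_one]

lemma localOp_smul_one (T : Finset ι) (c : ℂ) :
    localOp (d := d) T (c • 1) = c • 1 := by
  rw [localOp_eq_submatrix, Matrix.smul_kronecker, Matrix.one_kronecker_one,
    Matrix.submatrix_smul, Pi.smul_apply, Pi.smul_apply, Matrix.submatrix_one_equiv]

lemma localOp_zero (T : Finset ι) : localOp (d := d) T 0 = 0 := by
  simpa using localOp_smul_one (d := d) T 0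

/-- `M ⊗ 𝟙` determines `M`, as soon as the other parties have basis vectors. -/
lemma localOp_injective (T : Finset ι) (x₀ : Idx d) :
    Function.Injective (localOp (d := d) T) := by
  intro M N h
  ext a b
  have := congrFun (congrFun h fun i => if hi : i ∈ T then a ⟨i, hi⟩ else x₀ i)
    fun i => if hi : i ∈ T then b ⟨i, hi⟩ else x₀ i
  simp only [localOp] at this
  rw [if_pos, if_pos] at this
  · simpa using this
  all_goals intro i hi; simp [hi]

/-- Operators on complementary sets of parties commute. -/
lemma localOp_commute (S : Finset ι) (A : Matrix (SubIdx d S) (SubIdx d S) ℂ)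
    (B : Matrix (SubIdx d Sᶜ) (SubIdx d Sᶜ) ℂ) : Commute (localOp S A) (localOp Sᶜ B) := by
  ext x y
  -- both products have the entry `A x y * B x y`: only one intermediate label contributes
  rw [Matrix.mul_apply, Matrix.mul_apply,
    Finset.sum_eq_single (fun i => if i ∈ S then y i else x i),
    Finset.sum_eq_single (fun i => if i ∈ S then x i else y i)]
  · simp only [localOp]
    rw [if_pos, if_pos, if_pos, if_pos, mul_comm]
    · congr 1
      · congr 1 <;> funext i <;> simp [Finset.mem_compl.mp i.2]
      · congr 1 <;> funext i <;> simp
    all_goals intro i hi; simp_all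
  · intro z _ hz
    simp only [localOp]
    by_contra hne
    have h1 : ∀ i, i ∉ Sᶜ → x i = z i := by by_contra h; exact hne (by rw [if_neg h, zero_mul])
    have h2 : ∀ i, i ∉ S → z i = y i := by by_contra h; exact hne (by rw [if_neg h, mul_zero])
    refine hz (funext fun i => ?_)
    by_cases hi : i ∈ S
    · simp [hi, h1 i (by simpa using hi)]
    · simp [hi, h2 i hi]
  · simp
  · intro z _ hz
    simp only [localOp]
    by_contra hne
    have h1 : ∀ i, i ∉ S → x i = z i := by by_contra h; exact hne (by rw [if_neg h, zero_mul])
    have h2 : ∀ i, i ∉ Sᶜ → z i = y i := by by_contra h; exact hne (by rw [if_neg h, mul_zero])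
    refine hz (funext fun i => ?_)
    by_cases hi : i ∈ S
    · simp [hi, h2 i (by simpa using hi)]
    · simp [hi, h1 i hi]
  · simp

lemma localOp_apply_eq_zero {T : Finset ι} {i : ι} (hi : i ∉ T)
    (M : Matrix (SubIdx d T) (SubIdx d T) ℂ) {x y : Idx d} (h : x i ≠ y i) :
    localOp T M x y = 0 :=
  if_neg fun h' => h (h' i hi)

lemma localOp_apply_update {T : Finset ι} {i : ι} (hi : i ∉ T)
    (M : Matrix (SubIdx d T) (SubIdx d T) ℂ) {x y : Idx d} (h : x i = y i) (c : Fin (d i)) :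
    localOp T M (Function.update x i c) (Function.update y i c) = localOp T M x y := by
  have hx : ∀ z : Idx d, (fun j : T => Function.update z i c j) = fun j : T => z j := fun z =>
    funext fun j => Function.update_of_ne (fun e => hi (by rw [← e]; exact j.2)) _ _
  simp only [localOp, hx]
  refine if_congr (forall_congr' fun j => imp_congr_right fun _ => ?_) rfl rfl
  by_cases hj : j = i
  · subst hj; simp [h]
  · simp [hj]

end LocalOp

/-! ### The tiling by boxes, up to the position of each coordinate -/

/-- The position of a coordinate in `{0, …, n - 1}`: first, last or strictly between. Whether a
point lies in a box depends only on the levels of its coordinates. -/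
inductive Level
  | lo
  | mid
  | hi

/-- The level of a coordinate. -/
def level {n : ℕ} (t : Fin n) : Level :=
  if (t : ℕ) = 0 then .lo else if (t : ℕ) = n - 1 then .hi else .mid

/-- Whether the cell of a kind of tensor factor contains the coordinates of a given level. -/
def Side.has : Side → Level → Bool
  | .zero, .lo => true
  | .last, .hi => true
  | .eta, .lo => true
  | .eta, .mid => true
  | .xi, .mid => true
  | .xi, .hi => true
  | _, _ => false

/-- Whether the cell has more than one element. -/
def Side.isFree : Side → Bool
  | .eta => true
  | .xi => true
  | _ => false

/-- The level of the corner of a cell (`b = false`): the end of `{0, …, n - 1}` that the cell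
contains; and the other level that a cell with more than one element meets (`b = true`). -/
def Side.pos : Side → Bool → Level
  | .zero, _ => .lo
  | .last, _ => .hi
  | .eta, false => .lo
  | .xi, false => .hi
  | _, true => .mid

lemma Side.has_pos (σ : Side) (b : Bool) : σ.has (σ.pos b) = true := by
  cases σ <;> cases b <;> rfl

/-- Whether block `k` contains the points with the levels `p`. -/
def blockHas (k : Fin 16 ⊕ Fin 16) (p : Fin 5 → Level) : Bool :=
  (block k 0).has (p 0) && ((block k 1).has (p 1) && ((block k 2).has (p 2) &&
    ((block k 3).has (p 3) && (block k 4).has (p 4))))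

lemma blockHas_iff {k : Fin 16 ⊕ Fin 16} {p : Fin 5 → Level} :
    blockHas k p = true ↔ ∀ i, (block k i).has (p i) = true := by
  simp [blockHas, Fin.forall_fin_succ]

/-- Whether all blocks satisfy `f`. -/
def allBlocks (f : Fin 16 ⊕ Fin 16 → Bool) : Bool :=
  (List.finRange 16).all fun k => f (.inl k) && f (.inr k)

lemma allBlocks_iff {f : Fin 16 ⊕ Fin 16 → Bool} : allBlocks f = true ↔ ∀ k, f k = true := by
  simp [allBlocks, forall_and]

/-- Whether all Booleans satisfy `f`. -/
def allBools (f : Bool → Bool) : Bool := f false && f true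

lemma allBools_iff {f : Bool → Bool} : allBools f = true ↔ ∀ b, f b = true := by
  simp [allBools, Bool.forall_bool]

/-- Whether all levels satisfy `f`. -/
def allLevels (f : Level → Bool) : Bool := f .lo && (f .mid && f .hi)

lemma allLevels_iff {f : Level → Bool} : allLevels f = true ↔ ∀ a, f a = true := by
  simp only [allLevels, Bool.and_eq_true]
  exact ⟨fun h a => by cases a <;> simp [h], fun h => ⟨h _, h _, h _⟩⟩

/-- Whether a level belongs to interior coordinates. -/
def Level.isMid : Level → Bool
  | .mid => true
  | _ => false

lemma exists_blockHas {p : Fin 5 → Level} (hp : ∃ i, p i ≠ .mid) :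
    ∃ k, blockHas k p = true := by
  have key : (allLevels fun a => allLevels fun b => allLevels fun c => allLevels fun e =>
      allLevels fun f => (a.isMid && (b.isMid && (c.isMid && (e.isMid && f.isMid)))) ||
        !(allBlocks fun k => !blockHas k ![a, b, c, e, f])) = true := by
    decide +kernel
  simp only [allLevels_iff] at key
  have h := key (p 0) (p 1) (p 2) (p 3) (p 4)
  have hpe : ![p 0, p 1, p 2, p 3, p 4] = p := by
    funext i; fin_cases i <;> rfl
  rw [hpe, Bool.or_eq_true] at h
  rcases h with h | h
  · obtain ⟨i, hi⟩ := hp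
    have hmid : ∀ a : Level, a.isMid = true → a = .mid := fun a => by cases a <;> simp [Level.isMid]
    simp only [Bool.and_eq_true] at h
    refine absurd (hmid _ ?_) hi
    fin_cases i <;> simp_all
  · by_contra! hk
    rw [Bool.not_eq_true', ← Bool.not_eq_true, allBlocks_iff] at h
    exact h fun k => by simpa using hk k

lemma exists_not_isFree (k : Fin 16 ⊕ Fin 16) : ∃ i, (block k i).isFree = false := by
  have key : (allBlocks fun k => (List.finRange 5).any fun i => !(block k i).isFree) = true := by
    decide +kernel
  rw [allBlocks_iff] at key
  simpa using key k

/-- Two different blocks have disjoint cells for some party. -/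
lemma exists_disjoint_has {k l : Fin 16 ⊕ Fin 16} (h : k ≠ l) :
    ∃ i, ∀ a, (block k i).has a = false ∨ (block l i).has a = false := by
  have key : (allBlocks fun k => allBlocks fun l => decide (k = l) || (List.finRange 5).any fun i =>
      allLevels fun a => !((block k i).has a && (block l i).has a)) = true := by
    decide +kernel
  simp only [allBlocks_iff] at key
  simpa [h, allLevels_iff] using key k l

/-- The block at which the search for the diagonal entries stops, when the party `i` is left
out. The choice keeps the search short: at most five moves lead there from any block. -/
def rootBlock : Fin 5 → Fin 16 ⊕ Fin 16 := ![.inl 8, .inl 0, .inl 1, .inl 2, .inl 3]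

/-- A search, with `n` steps, that certifies the entries of an operator which acts trivially on
the party `i` at the pairs of points of block `k` that differ in the coordinates in `J`. Such a
pair may be moved inside the block to the corner or the opposite corner (with the second point
flipped in `J`), after which the coordinate `i` of both points is moved out of the block to one
of its end points. The pair is settled when its points lie in different blocks; for `J = ∅`, when
it has arrived in `rootBlock i`. -/
def reach (i : Fin 5) (J : Fin 5 → Bool) : ℕ → Fin 16 ⊕ Fin 16 → Bool
  | 0, _ => false
  | n + 1, k =>
    ((!(J 0 || (J 1 || (J 2 || (J 3 || J 4))))) && decide (k = rootBlock i)) ||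
    -- the order of `s`, and leaving the block, only matter for the size of the search tree
    [true, false].any fun s => [Level.lo, Level.hi].any fun c =>
      (!(block k i).has c) && allBlocks fun l =>
        (!blockHas l (Function.update (fun j => (block k j).pos s) i c)) ||
        ((!blockHas l (Function.update (fun j => (block k j).pos (s ^^ J j)) i c)) ||
        reach i J n l)

/-- The search settles all pairs of points in all blocks. -/
lemma reach_eq_true (i : Fin 5) (J : Fin 5 → Bool) (k : Fin 16 ⊕ Fin 16) (hi : J i = false)
    (hJ : ∀ j, J j = true → (block k j).isFree = true) : reach i J 6 k = true := by
  have key : ((List.finRange 5).all fun i => allBlocks fun k =>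
      allBools fun b₀ => allBools fun b₁ => allBools fun b₂ => allBools fun b₃ => allBools fun b₄ =>
      ![b₀, b₁, b₂, b₃, b₄] i ||
      ((b₀ && !(block k 0).isFree) || ((b₁ && !(block k 1).isFree) ||
      ((b₂ && !(block k 2).isFree) || ((b₃ && !(block k 3).isFree) ||
      ((b₄ && !(block k 4).isFree) || reach i ![b₀, b₁, b₂, b₃, b₄] 6 k)))))) = true := by
    decide +kernel
  simp only [List.all_eq_true, List.mem_finRange, true_imp_iff, allBlocks_iff, allBools_iff] at key
  have h := key i k (J 0) (J 1) (J 2) (J 3) (J 4)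
  have hJe : ![J 0, J 1, J 2, J 3, J 4] = J := by
    funext j; fin_cases j <;> rfl
  have hn : ∀ j, (J j && !(block k j).isFree) = false := fun j => by
    cases h' : J j <;> simp [hJ _, h']
  rwa [hJe, hi, hn, hn, hn, hn, hn] at h

/-! ### The states of a single party -/

lemma w_isPrimitiveRoot {n : ℕ} (hn : n ≠ 0) : IsPrimitiveRoot (w n) n :=
  Complex.isPrimitiveRoot_exp n hn

lemma star_w_mul_w (n : ℕ) : star (w n) * w n = 1 := by
  have h : ‖w n‖ = 1 := by
    rw [w, show 2 * (Real.pi : ℂ) * Complex.I / n = ((2 * Real.pi / n : ℝ) : ℂ) * Complex.I by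
      push_cast; ring, Complex.norm_exp_ofReal_mul_I]
  rw [mul_comm, Complex.star_def, Complex.mul_conj, Complex.normSq_eq_norm_sq, h]
  norm_num

lemma star_pow_w_mul_pow_w (n a : ℕ) : star (w n ^ a) * w n ^ a = 1 := by
  rw [star_pow, ← mul_pow, star_w_mul_w, one_pow]

/-- The phase `w_n ^ (r * (a - b))` depends only on `a - b` modulo `n`. -/
lemma phase_eq {n : ℕ} (hn : n ≠ 0) (r : ℕ) {a b a' b' : ℕ} (h : a + b' ≡ a' + b [MOD n]) :
    w n ^ (r * a) * star (w n ^ (r * b)) = w n ^ (r * a') * star (w n ^ (r * b')) := by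
  have hp : w n ^ (r * (a + b')) = w n ^ (r * (a' + b)) :=
    pow_eq_pow_of_modEq (h.mul_left r) (w_isPrimitiveRoot hn).pow_eq_one
  calc w n ^ (r * a) * star (w n ^ (r * b))
      = w n ^ (r * (a + b')) * star (w n ^ (r * b)) * star (w n ^ (r * b')) := by
        rw [mul_add, pow_add]
        linear_combination (-(w n ^ (r * a) * star (w n ^ (r * b)))) *
          star_pow_w_mul_pow_w n (r * b')
    _ = w n ^ (r * a') * star (w n ^ (r * b')) := by
        rw [hp, mul_add, pow_add]
        linear_combination (w n ^ (r * a') * star (w n ^ (r * b'))) *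
          star_pow_w_mul_pow_w n (r * b)

/-- Orthogonality of the characters of `ℤ / n`. -/
lemma sum_star_pow_mul_pow {n a b : ℕ} (ha : a < n) (hb : b < n) :
    ∑ k : Fin n, star (w n ^ (a * k)) * w n ^ (b * k) = if a = b then (n : ℂ) else 0 := by
  have hn : n ≠ 0 := by omega
  split_ifs with h
  · subst h
    simp_rw [star_pow_w_mul_pow_w]
    simp
  · set q := star (w n ^ a) * w n ^ b with hq
    have hsum : ∑ k : Fin n, star (w n ^ (a * k)) * w n ^ (b * k) =
        ∑ k ∈ Finset.range n, q ^ k := by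
      rw [← Fin.sum_univ_eq_sum_range]
      exact Finset.sum_congr rfl fun k _ => by rw [hq, mul_pow, pow_mul, pow_mul, star_pow]
    have hq1 : q ≠ 1 := fun e => h ((w_isPrimitiveRoot hn).pow_inj ha hb (by
      linear_combination (-(w n ^ a)) * e + (w n ^ b) * star_pow_w_mul_pow_w n a))
    have hqn : q ^ n = 1 := by
      rw [hq, mul_pow, ← star_pow, ← pow_mul, ← pow_mul, mul_comm a, mul_comm b, pow_mul, pow_mul,
        (w_isPrimitiveRoot hn).pow_eq_one]
      simp
    have := mul_neg_geom_sum q n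
    rw [hqn, sub_self] at this
    rw [hsum]
    exact (mul_eq_zero.mp this).resolve_left (sub_ne_zero.mpr hq1.symm)

lemma ket_eq_single {n : ℕ} (t : Fin n) : ket n t = Pi.single t 1 := by
  ext s
  simp [ket, Pi.single_apply, Fin.ext_iff]

lemma eta_castSucc (n s : ℕ) (t : Fin n) : eta (n + 1) s t.castSucc = w n ^ (s * t) := by
  simp [eta, ket, Finset.sum_apply]

lemma eta_last (n s : ℕ) : eta (n + 1) s (Fin.last n) = 0 := by
  simp [eta, ket, Finset.sum_apply]

lemma xi_succ (n s : ℕ) (t : Fin n) : xi (n + 1) s t.succ = w n ^ (s * t) := by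
  simp [xi, ket, Finset.sum_apply]

lemma xi_zero (n s : ℕ) : xi (n + 1) s 0 = 0 := by
  simp [xi, ket, Finset.sum_apply]

lemma star_mul_self_of_mem {n : ℕ} {σ : Side} {v : Fin (n) → ℂ}
    (hv : v ∈ sideStates (n) σ) {t : Fin (n)} (ht : t ∈ sideCell (n) σ) :
    v t * star (v t) = 1 := by
  obtain _ | n := n
  · exact t.elim0
  cases σ with
  | zero =>
    obtain rfl := hv
    simp_all [sideCell, ket]
  | last =>
    obtain rfl := hv
    simp_all [sideCell, ket]
  | eta =>
    obtain ⟨s, -, rfl⟩ := hv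
    induction t using Fin.lastCases with
    | last => simp [sideCell] at ht
    | cast t => rw [eta_castSucc, mul_comm, star_pow_w_mul_pow_w]
  | xi =>
    obtain ⟨s, -, rfl⟩ := hv
    induction t using Fin.cases with
    | zero => simp [sideCell] at ht
    | succ t => rw [xi_succ, mul_comm, star_pow_w_mul_pow_w]

lemma apply_eq_zero_of_notMem {n : ℕ} {σ : Side} {v : Fin (n) → ℂ}
    (hv : v ∈ sideStates (n) σ) {t : Fin (n)} (ht : t ∉ sideCell (n) σ) :
    v t = 0 := by
  obtain _ | n := n
  · exact t.elim0
  cases σ with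
  | zero =>
    obtain rfl := hv
    simp_all [sideCell, ket]
  | last =>
    obtain rfl := hv
    simp_all [sideCell, ket]
  | eta =>
    obtain ⟨s, -, rfl⟩ := hv
    induction t using Fin.lastCases with
    | last => exact eta_last n s
    | cast t => exact (by simp [sideCell] at ht)
  | xi =>
    obtain ⟨s, -, rfl⟩ := hv
    induction t using Fin.cases with
    | zero => exact xi_zero n s
    | succ t => simp [sideCell] at ht

lemma sideStates_orthogonal {n : ℕ} {σ : Side} {v u : Fin (n) → ℂ}
    (hv : v ∈ sideStates (n) σ) (hu : u ∈ sideStates (n) σ) (h : v ≠ u) :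
    star v ⬝ᵥ u = 0 := by
  obtain _ | n := n
  · exact absurd (Subsingleton.elim v u) h
  cases σ with
  | zero => exact absurd (hv.trans hu.symm) h
  | last => exact absurd (hv.trans hu.symm) h
  | eta =>
    obtain ⟨a, ha, rfl⟩ := hv
    obtain ⟨b, hb, rfl⟩ := hu
    simp only [dotProduct, Fin.sum_univ_castSucc, Pi.star_apply, eta_castSucc, eta_last, mul_zero,
      add_zero]
    rw [sum_star_pow_mul_pow (n := n) ha hb, if_neg (by rintro rfl; exact h rfl)]
  | xi =>
    obtain ⟨a, ha, rfl⟩ := hv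
    obtain ⟨b, hb, rfl⟩ := hu
    simp only [dotProduct, Fin.sum_univ_succ, Pi.star_apply, xi_succ, xi_zero, mul_zero, zero_add]
    rw [sum_star_pow_mul_pow (n := n) ha hb, if_neg (by rintro rfl; exact h rfl)]

/-- Fourier inversion: the states of a kind span the basis vectors of its cell. -/
lemma single_mem_span_sideStates {n : ℕ} {σ : Side} {t : Fin (n)}
    (ht : t ∈ sideCell (n) σ) :
    (Pi.single t 1 : Fin (n) → ℂ) ∈ Submodule.span ℂ (sideStates (n) σ) := by
  obtain _ | n := n
  · exact t.elim0
  cases σ with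
  | zero =>
    refine Submodule.subset_span ?_
    rw [← ket_eq_single, show (t : ℕ) = 0 from ht]
    rfl
  | last =>
    refine Submodule.subset_span ?_
    rw [← ket_eq_single, show (t : ℕ) = n + 1 - 1 from ht]
    rfl
  | eta =>
    induction t using Fin.lastCases with
    | last => simp [sideCell] at ht
    | cast t =>
      have hn : (n : ℂ) ≠ 0 := Nat.cast_ne_zero.mpr (by have := t.2; omega)
      have h : (Pi.single t.castSucc 1 : Fin (n + 1) → ℂ) =
          (n : ℂ)⁻¹ • ∑ s : Fin n, star (w n ^ ((t : ℕ) * s)) • eta (n + 1) s := by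
        ext t'
        induction t' using Fin.lastCases with
        | last =>
          simp [Finset.sum_apply, eta_last, (Fin.castSucc_lt_last t).ne']
        | cast t' =>
          simp only [Pi.smul_apply, Finset.sum_apply, smul_eq_mul, eta_castSucc]
          simp_rw [mul_comm _ (t' : ℕ)]
          rw [sum_star_pow_mul_pow t.2 t'.2]
          by_cases e : t = t'
          · subst e; simp [hn]
          · rw [if_neg (fun e' => e (Fin.ext e')), Pi.single_eq_of_ne (by simpa using Ne.symm e),
              mul_zero]
      rw [h]
      exact Submodule.smul_mem _ _ (Submodule.sum_mem _ fun s _ => Submodule.smul_mem _ _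
        (Submodule.subset_span ⟨s, s.2, rfl⟩))
  | xi =>
    induction t using Fin.cases with
    | zero => simp [sideCell] at ht
    | succ t =>
      have hn : (n : ℂ) ≠ 0 := Nat.cast_ne_zero.mpr (by have := t.2; omega)
      have h : (Pi.single t.succ 1 : Fin (n + 1) → ℂ) =
          (n : ℂ)⁻¹ • ∑ s : Fin n, star (w n ^ ((t : ℕ) * s)) • xi (n + 1) s := by
        ext t'
        induction t' using Fin.cases with
        | zero => simp [Finset.sum_apply, xi_zero, (Fin.succ_ne_zero t).symm]
        | succ t' =>
          simp only [Pi.smul_apply, Finset.sum_apply, smul_eq_mul, xi_succ]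
          simp_rw [mul_comm _ (t' : ℕ)]
          rw [sum_star_pow_mul_pow t.2 t'.2]
          by_cases e : t = t'
          · subst e; simp [hn]
          · rw [if_neg (fun e' => e (Fin.ext e')), Pi.single_eq_of_ne (by simpa using Ne.symm e),
              mul_zero]
      rw [h]
      exact Submodule.smul_mem _ _ (Submodule.sum_mem _ fun s _ => Submodule.smul_mem _ _
        (Submodule.subset_span ⟨s, s.2, rfl⟩))

lemma mem_sideCell_iff {n : ℕ} (hn : 3 ≤ n) {σ : Side} {t : Fin (n)} :
    t ∈ sideCell (n) σ ↔ σ.has (level t) = true := by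
  obtain _ | n := n
  · omega
  have := t.2
  cases σ <;> simp only [sideCell, Set.mem_ofPred_eq, level] <;> split_ifs <;>
    simp only [Side.has, iff_true, Bool.false_eq_true, iff_false] <;> omega

lemma exists_level_eq {n : ℕ} (hn : 3 ≤ n) (a : Level) : ∃ t : Fin (n), level t = a := by
  cases a
  · exact ⟨⟨0, by omega⟩, by simp [level]⟩
  · exact ⟨⟨1, by omega⟩, by rw [level, if_neg one_ne_zero, if_neg (by simp; omega)]⟩
  · exact ⟨⟨n - 1, by omega⟩, by rw [level, if_neg (by simp; omega), if_pos rfl]⟩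

lemma isFree_of_ne {n : ℕ} {σ : Side} {s t : Fin (n)} (hs : s ∈ sideCell (n) σ)
    (ht : t ∈ sideCell (n) σ) (h : s ≠ t) : σ.isFree = true := by
  cases σ with
  | zero =>
    exact absurd (Fin.ext ((show (s : ℕ) = 0 from hs).trans (show (t : ℕ) = 0 from ht).symm)) h
  | last =>
    exact absurd (Fin.ext ((show (s : ℕ) = n - 1 from hs).trans
      (show (t : ℕ) = n - 1 from ht).symm)) h
  | eta => rfl
  | xi => rfl

/-- Two different coordinates in a cell can be moved cyclically such that the first one becomes
the corner; this does not change the relative phases of the states. -/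
lemma exists_corner {n : ℕ} (hn : 3 ≤ n) {σ : Side} {s t : Fin (n)}
    (hs : s ∈ sideCell (n) σ) (ht : t ∈ sideCell (n) σ) (h : s ≠ t) :
    ∃ s' t' : Fin (n), level s' = σ.pos false ∧ level t' = σ.pos true ∧ s' ≠ t' ∧
      ∀ v ∈ sideStates (n) σ, v s * star (v t) = v s' * star (v t') := by
  obtain _ | n := n
  · omega
  cases σ with
  | zero =>
    exact absurd (Fin.ext ((show (s : ℕ) = 0 from hs).trans (show (t : ℕ) = 0 from ht).symm)) h
  | last =>
    exact absurd (Fin.ext ((show (s : ℕ) = n + 1 - 1 from hs).trans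
      (show (t : ℕ) = n + 1 - 1 from ht).symm)) h
  | eta =>
    induction s using Fin.lastCases with
    | last => simp [sideCell] at hs
    | cast s =>
    induction t using Fin.lastCases with
    | last => simp [sideCell] at ht
    | cast t =>
    have hst : (s : ℕ) ≠ t := fun e => h (by rw [Fin.ext e])
    have := s.2; have := t.2
    -- the corner has index `0`, so the index of `t'` is `t - s` modulo `n`
    obtain ⟨t', h0, h1, h2⟩ : ∃ t' : ℕ, 0 < t' ∧ t' < n ∧ s + t' ≡ 0 + t [MOD n] := by
      rcases lt_or_gt_of_ne hst with hlt | hlt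
      · exact ⟨t - s, by omega, by omega, by
          rw [show (s : ℕ) + (t - s) = 0 + t by omega]⟩
      · exact ⟨n + t - s, by omega, by omega, by
          rw [show (s : ℕ) + (n + t - s) = 0 + t + n by omega]; exact Nat.add_modEq_right⟩
    refine ⟨Fin.castSucc ⟨0, by omega⟩, Fin.castSucc ⟨t', h1⟩, by simp [level, Side.pos],
      ?_, by simpa [Fin.ext_iff] using h0.ne, ?_⟩
    · rw [level, if_neg (by simpa using h0.ne'), if_neg (by simpa using h1.ne)]
      rfl
    rintro _ ⟨r, -, rfl⟩
    simp only [eta_castSucc]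
    exact phase_eq (by omega) r h2
  | xi =>
    induction s using Fin.cases with
    | zero => simp [sideCell] at hs
    | succ s =>
    induction t using Fin.cases with
    | zero => simp [sideCell] at ht
    | succ t =>
    have hst : (s : ℕ) ≠ t := fun e => h (by rw [Fin.ext e])
    have := s.2; have := t.2
    -- the corner has index `n - 1`, so the index of `t'` is `t - s - 1` modulo `n`
    obtain ⟨t', h1, h2⟩ : ∃ t' : ℕ, t' < n - 1 ∧ s + t' ≡ (n - 1) + t [MOD n] := by
      rcases lt_or_gt_of_ne hst with hlt | hlt
      · exact ⟨t - s - 1, by omega, by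
          rw [show n - 1 + (t : ℕ) = s + (t - s - 1) + n by omega]
          exact Nat.add_modEq_right.symm⟩
      · exact ⟨n - 1 + t - s, by omega, by
          rw [show (s : ℕ) + (n - 1 + t - s) = n - 1 + t by omega]⟩
    refine ⟨Fin.succ ⟨n - 1, by omega⟩, Fin.succ ⟨t', by omega⟩, by simp [level, Side.pos]; omega,
      by simp [level, Side.pos]; omega, by simp [Fin.ext_iff]; omega, ?_⟩
    rintro _ ⟨r, -, rfl⟩
    simp only [xi_succ]
    exact phase_eq (by omega) r h2

/-- Two coordinates in a cell can be moved, without changing the relative phases of the states,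
such that the first one gets a prescribed position. -/
lemma exists_pos {n : ℕ} (hn : 3 ≤ n) {σ : Side} {s t : Fin (n)}
    (hs : s ∈ sideCell (n) σ) (ht : t ∈ sideCell (n) σ) (b : Bool) :
    ∃ s' t' : Fin (n), level s' = σ.pos b ∧ level t' = σ.pos (b ^^ decide (s ≠ t)) ∧
      (s' = t' ↔ s = t) ∧
      ∀ v ∈ sideStates (n) σ, v s * star (v t) = v s' * star (v t') := by
  by_cases h : s = t
  · subst h
    obtain ⟨s', hs'⟩ := exists_level_eq hn (σ.pos b)
    refine ⟨s', s', hs', by simpa using hs', by simp, fun v hv => ?_⟩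
    rw [star_mul_self_of_mem hv hs, star_mul_self_of_mem hv ((mem_sideCell_iff hn).mpr
      (by rw [hs', Side.has_pos]))]
  · cases b with
    | false =>
      obtain ⟨s', t', h1, h2, h3, h4⟩ := exists_corner hn hs ht h
      exact ⟨s', t', h1, by simpa [h] using h2, by simp [h, h3], h4⟩
    | true =>
      obtain ⟨t', s', h1, h2, h3, h4⟩ := exists_corner hn ht hs (Ne.symm h)
      refine ⟨s', t', h2, by simpa [h] using h1, by simp [h, h3.symm], fun v hv => ?_⟩
      simpa [mul_comm] using congrArg star (h4 v hv)

/-! ### Product states and blocks -/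

section ProductState

variable {ι : Type} [Fintype ι] {d : ι → ℕ}

lemma productState_single (x : Idx d) :
    productState (fun i => (Pi.single (x i) 1 : Fin (d i) → ℂ)) = Pi.single x 1 := by
  ext y
  by_cases h : y = x
  · subst h; simp [productState]
  · obtain ⟨i, hi⟩ := Function.ne_iff.mp h
    rw [Pi.single_eq_of_ne h, productState, Finset.prod_eq_zero (Finset.mem_univ i)]
    exact Pi.single_eq_of_ne hi _

variable [DecidableEq ι]

lemma star_productState_dotProduct (v u : ∀ i, Fin (d i) → ℂ) :
    star (productState v) ⬝ᵥ productState u = ∏ i, star (v i) ⬝ᵥ u i := by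
  simp only [dotProduct, productState, Pi.star_apply, star_prod, Finset.prod_univ_sum,
    Fintype.piFinset_univ, Finset.prod_mul_distrib]

lemma productState_update_add (v : ∀ i, Fin (d i) → ℂ) (i : ι) (a b : Fin (d i) → ℂ) :
    productState (Function.update v i (a + b)) =
      productState (Function.update v i a) + productState (Function.update v i b) := by
  ext x
  simp only [productState, Pi.add_apply, ← Finset.mul_prod_erase _ _ (Finset.mem_univ i),
    Function.update_self, add_mul]
  congr 2 <;> refine Finset.prod_congr rfl fun j hj => ?_ <;>
    simp [Function.update_of_ne (Finset.ne_of_mem_erase hj)]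

lemma productState_update_smul (v : ∀ i, Fin (d i) → ℂ) (i : ι) (c : ℂ) (a : Fin (d i) → ℂ) :
    productState (Function.update v i (c • a)) = c • productState (Function.update v i a) := by
  ext x
  simp only [productState, Pi.smul_apply, ← Finset.mul_prod_erase _ _ (Finset.mem_univ i),
    Function.update_self, smul_eq_mul, mul_assoc]
  congr 2
  refine Finset.prod_congr rfl fun j hj => ?_
  simp [Function.update_of_ne (Finset.ne_of_mem_erase hj)]

/-- The product of vectors in the spans of sets `S i` lies in the span of the products of vectors
in these sets. -/
lemma productState_mem_span {S : ∀ i, Set (Fin (d i) → ℂ)} {v : ∀ i, Fin (d i) → ℂ}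
    (hv : ∀ i, v i ∈ Submodule.span ℂ (S i)) :
    productState v ∈ Submodule.span ℂ {ψ | ∃ u, (∀ i, u i ∈ S i) ∧ ψ = productState u} := by
  -- the factors in `I` are replaced one after the other
  suffices h : ∀ I : Finset ι, ∀ v : ∀ i, Fin (d i) → ℂ, (∀ i ∈ I, v i ∈ Submodule.span ℂ (S i)) →
      (∀ i ∉ I, v i ∈ S i) →
      productState v ∈ Submodule.span ℂ {ψ | ∃ u, (∀ i, u i ∈ S i) ∧ ψ = productState u} from
    h Finset.univ v (fun i _ => hv i) fun i hi => absurd (Finset.mem_univ i) hi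
  intro I
  induction I using Finset.induction with
  | empty => exact fun v _ hv => Submodule.subset_span ⟨v, fun i => hv i (by simp), rfl⟩
  | insert a I ha ih =>
    intro v h1 h2
    have key : ∀ u ∈ Submodule.span ℂ (S a), productState (Function.update v a u) ∈
        Submodule.span ℂ {ψ | ∃ u, (∀ i, u i ∈ S i) ∧ ψ = productState u} := by
      intro u hu
      induction hu using Submodule.span_induction with
      | mem u hu =>
        refine ih _ (fun i hi => ?_) fun i hi => ?_
        · rw [Function.update_of_ne (ne_of_mem_of_not_mem hi ha)]
          exact h1 i (Finset.mem_insert_of_mem hi)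
        · by_cases e : i = a
          · subst e; rwa [Function.update_self]
          · rw [Function.update_of_ne e]
            exact h2 i (by simp [e, hi])
      | zero =>
        rw [show productState (Function.update v a 0) = 0 by
          simpa using productState_update_smul v a 0 0]
        exact Submodule.zero_mem _
      | add x y _ _ hx hy => rw [productState_update_add]; exact add_mem hx hy
      | smul c x _ hx => rw [productState_update_smul]; exact Submodule.smul_mem _ c hx
    simpa using key (v a) (h1 a (Finset.mem_insert_self a I))

/-- A vector supported in `B` lies in the span of the basis vectors in `B`. -/
lemma mem_span_single_image {B : Set (Idx d)} {ψ : State d} (h : ∀ x ∉ B, ψ x = 0) :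
    ψ ∈ Submodule.span ℂ ((fun x : Idx d => (Pi.single x 1 : State d)) '' B) := by
  rw [pi_eq_sum_univ' ψ]
  refine Submodule.sum_mem _ fun x _ => ?_
  by_cases hx : x ∈ B
  · refine Submodule.smul_mem _ _ (Submodule.subset_span ⟨x, hx, ?_⟩)
    ext y
    simp [Pi.single_apply, eq_comm]
  · rw [h x hx, zero_smul]
    exact Submodule.zero_mem _

end ProductState

section Block

variable {d : Fin 5 → ℕ} {b : Fin 5 → Side}

/-- The coordinates of the states of a block have modulus one on its box. -/
lemma blockStates_mul_star_self {ψ : State d} (hψ : ψ ∈ blockStates d b) {x : Idx d}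
    (hx : x ∈ blockBox d b) : ψ x * star (ψ x) = 1 := by
  obtain ⟨v, hv, rfl⟩ := hψ
  rw [productState, star_prod, ← Finset.prod_mul_distrib]
  exact Finset.prod_eq_one fun i _ => star_mul_self_of_mem (hv i) (hx i)

lemma blockStates_apply_ne_zero {ψ : State d} (hψ : ψ ∈ blockStates d b) {x : Idx d}
    (hx : x ∈ blockBox d b) : ψ x ≠ 0 :=
  left_ne_zero_of_mul_eq_one (blockStates_mul_star_self hψ hx)

lemma blockStates_apply_eq_zero {ψ : State d} (hψ : ψ ∈ blockStates d b) {x : Idx d}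
    (hx : x ∉ blockBox d b) : ψ x = 0 := by
  obtain ⟨v, hv, rfl⟩ := hψ
  obtain ⟨i, hi⟩ := not_forall.mp hx
  exact Finset.prod_eq_zero (Finset.mem_univ i) (apply_eq_zero_of_notMem (hv i) hi)

lemma blockStates_orthogonal {ψ φ : State d} (hψ : ψ ∈ blockStates d b)
    (hφ : φ ∈ blockStates d b) (h : ψ ≠ φ) : star ψ ⬝ᵥ φ = 0 := by
  obtain ⟨v, hv, rfl⟩ := hψ
  obtain ⟨u, hu, rfl⟩ := hφ
  obtain ⟨i, hi⟩ := Function.ne_iff.mp (fun e => h (congrArg productState e))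
  rw [star_productState_dotProduct]
  exact Finset.prod_eq_zero (Finset.mem_univ i) (sideStates_orthogonal (hv i) (hu i) hi)

lemma single_mem_span_blockStates {x : Idx d} (hx : x ∈ blockBox d b) :
    (Pi.single x 1 : State d) ∈ Submodule.span ℂ (blockStates d b) := by
  rw [← productState_single]
  exact productState_mem_span fun i => single_mem_span_sideStates (hx i)

lemma span_blockStates (d : Fin 5 → ℕ) (b : Fin 5 → Side) :
    Submodule.span ℂ (blockStates d b) =
      Submodule.span ℂ ((fun x : Idx d => (Pi.single x 1 : State d)) '' blockBox d b) := by
  refine le_antisymm (Submodule.span_le.mpr fun ψ hψ => ?_) (Submodule.span_le.mpr ?_)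
  · exact mem_span_single_image fun x hx => blockStates_apply_eq_zero hψ hx
  · rintro _ ⟨x, hx, rfl⟩
    exact single_mem_span_blockStates hx

lemma mem_blockBox_iff (hd : ∀ i, 3 ≤ d i) {k : Fin 16 ⊕ Fin 16} {x : Idx d} :
    x ∈ blockBox d (block k) ↔ blockHas k (fun i => level (x i)) = true := by
  rw [blockHas_iff]
  exact forall_congr' fun i => mem_sideCell_iff (hd i)

lemma blockBox_nonempty (hd : ∀ i, 3 ≤ d i) (k : Fin 16 ⊕ Fin 16) :
    (blockBox d (block k)).Nonempty := by
  choose x hx using fun i => exists_level_eq (hd i) ((block k i).pos false)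
  exact ⟨x, (mem_blockBox_iff hd).mpr (blockHas_iff.mpr fun i => by rw [hx, Side.has_pos])⟩

lemma level_ne_mid_iff {n : ℕ} {t : Fin n} :
    level t ≠ .mid ↔ (t : ℕ) = 0 ∨ (t : ℕ) = n - 1 := by
  rw [level]; split_ifs <;> simp_all

lemma pairwise_disjoint_blockBox (hd : ∀ i, 3 ≤ d i) :
    Pairwise fun k l => Disjoint (blockBox d (block k)) (blockBox d (block l)) := by
  intro k l hkl
  rw [Set.disjoint_left]
  intro x hk hl
  rw [mem_blockBox_iff hd, blockHas_iff] at hk hl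
  obtain ⟨i, hi⟩ := exists_disjoint_has hkl
  rcases hi (level (x i)) with h | h
  · simp [hk i] at h
  · simp [hl i] at h

lemma exists_mem_blockBox (hd : ∀ i, 3 ≤ d i) {x : Idx d} (hx : ∃ i, level (x i) ≠ .mid) :
    ∃ k, x ∈ blockBox d (block k) := by
  simp only [mem_blockBox_iff hd]
  exact exists_blockHas hx

lemma iUnion_blockBox (hd : ∀ i, 3 ≤ d i) :
    ⋃ k, blockBox d (block k) = outermostLayer d := by
  ext x
  simp only [Set.mem_iUnion, outermostLayer, Set.mem_ofPred_eq, ← level_ne_mid_iff]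
  refine ⟨fun ⟨k, hk⟩ => ?_, exists_mem_blockBox hd⟩
  rw [mem_blockBox_iff hd, blockHas_iff] at hk
  obtain ⟨i, hi⟩ := exists_not_isFree k
  refine ⟨i, fun h => ?_⟩
  have := hk i
  rw [h] at this
  cases e : block k i <;> simp_all [Side.isFree, Side.has]

lemma blockStates_ne_of_ne (hd : ∀ i, 3 ≤ d i) {k l : Fin 16 ⊕ Fin 16} (hkl : k ≠ l)
    {ψ φ : State d} (hψ : ψ ∈ blockStates d (block k)) (hφ : φ ∈ blockStates d (block l)) :
    ψ ≠ φ := by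
  rintro rfl
  obtain ⟨x, hx⟩ := blockBox_nonempty hd k
  exact blockStates_apply_ne_zero hψ hx (blockStates_apply_eq_zero hφ
    (Set.disjoint_left.mp (pairwise_disjoint_blockBox hd hkl) hx))

lemma isOrthogonalProductSet_opsFive (hd : ∀ i, 3 ≤ d i) :
    IsOrthogonalProductSet (opsFive d) := by
  refine ⟨fun ψ hψ => ?_, fun ψ hψ φ hφ h => ?_⟩
  · obtain ⟨k, hk⟩ := Set.mem_iUnion.mp hψ
    obtain ⟨x, hx⟩ := blockBox_nonempty hd k
    refine ⟨fun h => blockStates_apply_ne_zero hk hx (congrFun h x), ?_⟩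
    obtain ⟨v, -, hv⟩ := hk
    exact ⟨v, hv⟩
  · obtain ⟨k, hk⟩ := Set.mem_iUnion.mp hψ
    obtain ⟨l, hl⟩ := Set.mem_iUnion.mp hφ
    by_cases hkl : k = l
    · subst hkl
      exact blockStates_orthogonal hk hl h
    · refine Finset.sum_eq_zero fun x _ => ?_
      by_cases hx : x ∈ blockBox d (block k)
      · rw [blockStates_apply_eq_zero hl
          (Set.disjoint_left.mp (pairwise_disjoint_blockBox hd hkl) hx), mul_zero]
      · rw [Pi.star_apply, blockStates_apply_eq_zero hk hx, star_zero, zero_mul]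

end Block

/-! ### The number of states -/

lemma card_level_mid {n : ℕ} (hn : 2 ≤ n) :
    (Finset.univ.filter fun t : Fin n => ¬((t : ℕ) = 0 ∨ (t : ℕ) = n - 1)).card = n - 2 := by
  have h : (Finset.univ.filter fun t : Fin n => ¬((t : ℕ) = 0 ∨ (t : ℕ) = n - 1)) =
      ({⟨0, by omega⟩, ⟨n - 1, by omega⟩} : Finset (Fin n))ᶜ := by
    ext t
    simp [Fin.ext_iff]
  rw [h, Finset.card_compl, Finset.card_pair (by simp [Fin.ext_iff]; omega), Fintype.card_fin]

lemma ncard_outermostLayer {ι : Type} [Fintype ι] [DecidableEq ι] {d : ι → ℕ}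
    (hd : ∀ i, 2 ≤ d i) : (outermostLayer d).ncard = ∏ i, d i - ∏ i, (d i - 2) := by
  have h : outermostLayer d = ((Fintype.piFinset fun i =>
      Finset.univ.filter fun t : Fin (d i) => ¬((t : ℕ) = 0 ∨ (t : ℕ) = d i - 1))ᶜ :
        Finset (Idx d)) := by
    ext x
    simp only [outermostLayer, Set.mem_ofPred_eq, Finset.coe_compl, Set.mem_compl_iff,
      Finset.mem_coe, Fintype.mem_piFinset, Finset.mem_filter, Finset.mem_univ, true_and,
      not_forall, not_not]
  rw [h, Set.ncard_coe_finset, Finset.card_compl, Fintype.card_piFinset, Fintype.card_pi]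
  simp only [card_level_mid (hd _), Fintype.card_fin]

/-- The states are linearly independent and have the same span as the basis vectors in the
outermost layer. -/
lemma ncard_opsFive {d : Fin 5 → ℕ} (hd : ∀ i, 3 ≤ d i) :
    (opsFive d).ncard = ∏ i, d i - ∏ i, (d i - 2) := by
  have hX := isOrthogonalProductSet_opsFive hd
  have hli := linearIndepOn_of_orthogonal (fun ψ hψ => (hX.1 ψ hψ).1) hX.2
  have hB : LinearIndepOn ℂ id
      ((fun x : Idx d => (Pi.single x 1 : State d)) '' outermostLayer d) := by
    have := (Pi.basisFun ℂ (Idx d)).linearIndependent.linearIndepOn (s := outermostLayer d)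
    simpa [Pi.basisFun_apply] using this.id_image
  have hspan : Submodule.span ℂ (opsFive d) = Submodule.span ℂ
      ((fun x : Idx d => (Pi.single x 1 : State d)) '' outermostLayer d) := by
    rw [opsFive, ← iUnion_blockBox hd, Set.image_iUnion, Submodule.span_iUnion,
      Submodule.span_iUnion]
    exact iSup_congr fun k => span_blockStates d _
  rw [← ncard_outermostLayer fun i => (by omega : 2 ≤ 3).trans (hd i),
    ← Set.ncard_image_of_injective (outermostLayer d)
      (f := fun x : Idx d => (Pi.single x 1 : State d)) (fun x y h => by
        by_contra hne
        simpa [Pi.single_eq_of_ne hne] using congrFun h x)]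
  have hcard : ∀ X : Set (State d), LinearIndepOn ℂ id X →
      X.ncard = Module.finrank ℂ (Submodule.span ℂ X) := fun X hX => by
    have := hX.setFinite.fintype
    rw [finrank_span_set_eq_card hX, Set.ncard_eq_toFinset_card']
  rw [hcard _ hli, hcard _ hB, hspan]

/-! ### Orthogonality-preserving local operators -/

section Local

variable {d : Fin 5 → ℕ} {i : Fin 5} {G : Matrix (Idx d) (Idx d) ℂ}

lemma apply_eq_zero_of_mem_blockBox (hd : ∀ i, 3 ≤ d i)
    (hX : ∀ ψ ∈ opsFive d, ∀ φ ∈ opsFive d, ψ ≠ φ → star ψ ⬝ᵥ (G *ᵥ φ) = 0)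
    {k l : Fin 16 ⊕ Fin 16} (hkl : k ≠ l) {x y : Idx d} (hx : x ∈ blockBox d (block k))
    (hy : y ∈ blockBox d (block l)) : G x y = 0 := by
  rw [← star_single_dotProduct_mulVec G x y]
  exact star_dotProduct_mulVec_eq_zero_of_mem_span
    (fun ψ hψ φ hφ => hX ψ (Set.mem_iUnion_of_mem k hψ) φ (Set.mem_iUnion_of_mem l hφ)
      (blockStates_ne_of_ne hd hkl hψ hφ))
    (single_mem_span_blockStates hx) (single_mem_span_blockStates hy)

lemma apply_eq_apply_of_mem_blockBox (hd : ∀ i, 3 ≤ d i)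
    (hX : ∀ ψ ∈ opsFive d, ∀ φ ∈ opsFive d, ψ ≠ φ → star ψ ⬝ᵥ (G *ᵥ φ) = 0)
    {k : Fin 16 ⊕ Fin 16} {x y x' y' : Idx d} (hx : x ∈ blockBox d (block k))
    (hy : y ∈ blockBox d (block k)) (hx' : x' ∈ blockBox d (block k))
    (hy' : y' ∈ blockBox d (block k))
    (h : ∀ ψ ∈ blockStates d (block k), ψ x * star (ψ y) = ψ x' * star (ψ y')) :
    G x y = G x' y' := by
  have hO := isOrthogonalProductSet_opsFive hd
  have hsub := Set.subset_iUnion (fun k => blockStates d (block k)) k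
  exact apply_eq_apply_of_phase_eq (fun ψ hψ => (hO.1 ψ (hsub hψ)).1)
    (fun ψ hψ φ hφ => hO.2 ψ (hsub hψ) φ (hsub hφ))
    (fun ψ hψ φ hφ => hX ψ (hsub hψ) φ (hsub hφ))
    (single_mem_span_blockStates hx) (single_mem_span_blockStates hy)
    (single_mem_span_blockStates hx') (single_mem_span_blockStates hy') h

/-- Two points of the outermost layer lie in different blocks or in the same block; in the first
case the entry is known. -/
lemma apply_eq_ite_of_mem_layer (hd : ∀ i, 3 ≤ d i)
    (hX : ∀ ψ ∈ opsFive d, ∀ φ ∈ opsFive d, ψ ≠ φ → star ψ ⬝ᵥ (G *ᵥ φ) = 0) {g : ℂ}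
    {x y : Idx d} (hx : level (x i) ≠ .mid) (hxy : x i = y i)
    (h : ∀ l, x ∈ blockBox d (block l) → y ∈ blockBox d (block l) →
      G x y = if x = y then g else 0) : G x y = if x = y then g else 0 := by
  obtain ⟨k, hk⟩ := exists_mem_blockBox hd ⟨i, hx⟩
  obtain ⟨l, hl⟩ := exists_mem_blockBox hd ⟨i, hxy ▸ hx⟩
  by_cases hkl : k = l
  · subst hkl
    exact h k hk hl
  · rw [apply_eq_zero_of_mem_blockBox hd hX hkl hk hl, if_neg]
    rintro rfl
    exact Set.disjoint_left.mp (pairwise_disjoint_blockBox hd hkl) hk hl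

/-- Soundness of the search `reach`. -/
lemma apply_eq_ite_of_reach (hd : ∀ i, 3 ≤ d i)
    (hX : ∀ ψ ∈ opsFive d, ∀ φ ∈ opsFive d, ψ ≠ φ → star ψ ⬝ᵥ (G *ᵥ φ) = 0)
    (hG : ∀ x y : Idx d, x i = y i → ∀ c, G (Function.update x i c) (Function.update y i c) = G x y)
    {x₀ : Idx d} (hx₀ : x₀ ∈ blockBox d (block (rootBlock i))) {J : Fin 5 → Bool} (n : ℕ) :
    ∀ k, reach i J n k = true → ∀ x ∈ blockBox d (block k), ∀ y ∈ blockBox d (block k),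
      x i = y i → (∀ j, J j = decide (x j ≠ y j)) → G x y = if x = y then G x₀ x₀ else 0 := by
  induction n with
  | zero => exact fun k h => absurd h (by simp [reach])
  | succ n ih =>
    intro k hr x hx y hy hxy hJ
    rw [reach, Bool.or_eq_true] at hr
    rcases hr with hr | hr
    · have hJ0 : ∀ j, J j = false := by
        simp only [Bool.and_eq_true, Bool.not_eq_true', Bool.or_eq_false_iff] at hr
        intro j
        fin_cases j <;> simp_all
      have hxy' : x = y := funext fun j => by simpa [hJ0] using hJ j
      have hk : k = rootBlock i := by
        simp only [Bool.and_eq_true, decide_eq_true_eq] at hr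
        exact hr.2
      subst hk hxy'
      rw [if_pos rfl]
      exact apply_eq_apply_of_mem_blockBox hd hX hx hx hx₀ hx₀ fun ψ hψ => by
        rw [blockStates_mul_star_self hψ hx, blockStates_mul_star_self hψ hx₀]
    · simp only [List.any_eq_true] at hr
      obtain ⟨s, -, a, ha, hr⟩ := hr
      rw [Bool.and_eq_true, allBlocks_iff] at hr
      -- `x', y'` is the pair moved inside the block, `p, q` the pair moved on in the direction `i`
      choose x' y' hx' hy' hxy' hph using fun j => exists_pos (hd j) (hx j) (hy j) s
      have hmem : ∀ z : Idx d, (∀ j, ∃ b, level (z j) = (block k j).pos b) →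
          z ∈ blockBox d (block k) := fun z hz => (mem_blockBox_iff hd).mpr
        (blockHas_iff.mpr fun j => by obtain ⟨b, hb⟩ := hz j; rw [hb, Side.has_pos])
      have hmove : G x y = G x' y' := by
        refine apply_eq_apply_of_mem_blockBox hd hX hx hy (hmem x' fun j => ⟨_, hx' j⟩)
          (hmem y' fun j => ⟨_, hy' j⟩) ?_
        rintro _ ⟨v, hv, rfl⟩
        simp only [productState, star_prod, ← Finset.prod_mul_distrib]
        exact Finset.prod_congr rfl fun j _ => hph j (v j) (hv j)
      obtain ⟨c, hc⟩ := exists_level_eq (hd i) a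
      have hi' : x' i = y' i := (hxy' i).mpr hxy
      set p := Function.update x' i c with hp
      set q := Function.update y' i c with hq
      have hpq : ∀ j, p j = q j ↔ x j = y j := fun j => by
        by_cases hj : j = i
        · subst hj; simp [hp, hq, hxy]
        · simp [hp, hq, hj, hxy']
      have hpl : (fun j => level (p j)) = Function.update (fun j => (block k j).pos s) i a := by
        funext j
        by_cases hj : j = i
        · subst hj; simp [hp, hc]
        · simp [hp, hj, hx']
      have hql : (fun j => level (q j)) =
          Function.update (fun j => (block k j).pos (s ^^ J j)) i a := by
        funext j
        by_cases hj : j = i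
        · subst hj; simp [hq, hc]
        · simp only [hq, Function.update_of_ne hj, hy', hJ]
      have hne : a ≠ .mid := by rintro rfl; simp at ha
      rw [hmove, ← hG x' y' hi' c, ← hp, ← hq,
        if_congr (show x = y ↔ p = q by simp only [funext_iff, hpq]) rfl rfl]
      refine apply_eq_ite_of_mem_layer hd hX (i := i) (by simpa [hp, hc] using hne)
        ((hpq i).mpr hxy) fun l hpl' hql' => ?_
      have h := hr.2 l
      rw [← hpl, ← hql, (mem_blockBox_iff hd).mp hpl', (mem_blockBox_iff hd).mp hql'] at h
      exact ih l (by simpa using h) p hpl' q hql' ((hpq i).mpr hxy) fun j => by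
        rw [hJ, decide_not, decide_not]; simp only [hpq]

/-- A form that acts trivially on the party `i` and vanishes between different states of the set
is a multiple of the identity. -/
lemma exists_eq_smul_one (hd : ∀ i, 3 ≤ d i)
    (hX : ∀ ψ ∈ opsFive d, ∀ φ ∈ opsFive d, ψ ≠ φ → star ψ ⬝ᵥ (G *ᵥ φ) = 0)
    (h0 : ∀ x y : Idx d, x i ≠ y i → G x y = 0)
    (hG : ∀ x y : Idx d, x i = y i →
      ∀ c, G (Function.update x i c) (Function.update y i c) = G x y) :
    ∃ g : ℂ, G = g • 1 := by
  obtain ⟨x₀, hx₀⟩ := blockBox_nonempty hd (rootBlock i)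
  refine ⟨G x₀ x₀, ?_⟩
  ext x y
  rw [Matrix.smul_apply, Matrix.one_apply, smul_eq_mul, mul_ite, mul_one, mul_zero]
  by_cases hxy : x i = y i
  · -- moving the coordinate `i` of both points to `0` brings them into the outermost layer
    obtain ⟨c, hc⟩ := exists_level_eq (hd i) .lo
    rw [← hG x y hxy c]
    set p := Function.update x i c with hp
    set q := Function.update y i c with hq
    have hpq : p = q ↔ x = y := by
      simp only [funext_iff]
      refine forall_congr' fun j => ?_
      by_cases hj : j = i
      · subst hj; simp [hp, hq, hxy]
      · simp [hp, hq, hj]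
    have hi : p i = q i := by simp [hp, hq]
    rw [if_congr hpq.symm rfl rfl]
    refine apply_eq_ite_of_mem_layer hd hX (i := i) (by simp [hp, hc]) hi fun l hpl hql => ?_
    refine apply_eq_ite_of_reach hd hX hG hx₀ 6 l (J := fun j => decide (p j ≠ q j))
      (reach_eq_true i _ l (by simp [hi]) fun j hj => ?_) p hpl q hql hi fun j => rfl
    exact isFree_of_ne (hpl j) (hql j) (by simpa using hj)
  · rw [h0 x y hxy, if_neg (fun h => hxy (congrFun h i))]

/-- Orthogonality-preserving operators on the joint system of a proper subset of the parties are
multiples of isometries. -/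
lemma exists_conjTranspose_mul_self_eq (hd : ∀ i, 3 ≤ d i) {T : Finset (Fin 5)}
    (hT : T ≠ Finset.univ) {M : Matrix (SubIdx d T) (SubIdx d T) ℂ}
    (hM : OrthogonalImages (opsFive d) (localOp T M)) : ∃ c : ℂ, Mᴴ * M = c • 1 := by
  obtain ⟨i, hi⟩ : ∃ i, i ∉ T := by simpa [Finset.eq_univ_iff_forall] using hT
  have hE : localOp T (Mᴴ * M) = (localOp T M)ᴴ * localOp T M := by
    rw [localOp_mul, localOp_conjTranspose]
  obtain ⟨c, hc⟩ := exists_eq_smul_one (i := i) (G := localOp T (Mᴴ * M)) hd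
    (fun ψ hψ φ hφ h => by
      rw [hE, ← star_mulVec_dotProduct_mulVec]; exact hM ψ hψ φ hφ h)
    (fun x y h => localOp_apply_eq_zero hi _ h)
    (fun x y h c => localOp_apply_update hi _ h c)
  -- any point serves to fill the coordinates outside `T`
  obtain ⟨x₀, -⟩ := blockBox_nonempty hd (rootBlock i)
  exact ⟨c, localOp_injective T x₀ (by rw [hc, localOp_smul_one])⟩

end Local

/-! ### Local irreducibility -/

section Branch

variable {ι : Type} [Fintype ι] [DecidableEq ι] {d : ι → ℕ} {X : Set (State d)}

lemma orthogonalImages_of_mul {P Q : Matrix (Idx d) (Idx d) ℂ} (hPQ : Commute P Q) {b : ℂ}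
    (hb : b ≠ 0) (hQ : Qᴴ * Q = b • 1) (h : OrthogonalImages X (P * Q)) :
    OrthogonalImages X P := by
  intro ψ hψ φ hφ hne
  have := h ψ hψ φ hφ hne
  have e : (Q * P)ᴴ * (Q * P) = b • (Pᴴ * P) := by
    rw [Matrix.conjTranspose_mul, mul_assoc, ← mul_assoc Qᴴ, hQ, smul_mul_assoc, one_mul,
      mul_smul_comm]
  rw [star_mulVec_dotProduct_mulVec, hPQ.eq, e, Matrix.smul_mulVec, dotProduct_smul,
    smul_eq_mul] at this
  rw [star_mulVec_dotProduct_mulVec]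
  exact (mul_eq_zero.mp this).resolve_left hb

lemma localOp_conjTranspose_mul_self {T : Finset ι} {M : Matrix (SubIdx d T) (SubIdx d T) ℂ}
    {c : ℂ} (h : Mᴴ * M = c • 1) : (localOp T M)ᴴ * localOp T M = c • 1 := by
  rw [← localOp_conjTranspose, ← localOp_mul, h, localOp_smul_one]

/-- If the orthogonality-preserving local operators of the two sides are multiples of isometries,
then the operators of all branches are products of such operators: the next measurement operator
of one side, multiplied with the previous ones of this side, is again orthogonality-preserving,
since the operators of the other side act as a multiple of an isometry. -/
lemma Branch.exists_eq_mul {S : Finset ι}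
    (h : ∀ T, (T = S ∨ T = Sᶜ) → ∀ M, OrthogonalImages X (localOp T M) → ∃ c : ℂ, Mᴴ * M = c • 1)
    {K : Matrix (Idx d) (Idx d) ℂ} (hK : Branch X S K) :
    ∃ A B, K = localOp S A * localOp Sᶜ B ∧ (∃ a : ℂ, Aᴴ * A = a • 1) ∧
      ∃ b : ℂ, Bᴴ * B = b • 1 := by
  have hone : ∀ T, localOp (d := d) T 1 = 1 := fun T => by simpa using localOp_smul_one (d := d) T 1
  have hzero : ∀ T, ∀ M : Matrix (SubIdx d T) (SubIdx d T) ℂ, ∀ c : ℂ, Mᴴ * M = c • 1 → c = 0 →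
      localOp T M = 0 := fun T M c hM hc => by
    rw [hc, zero_smul] at hM
    rw [eq_zero_of_conjTranspose_mul_self_eq_zero hM, localOp_zero]
  induction hK with
  | start => exact ⟨1, 1, by simp [hone], ⟨1, by simp⟩, 1, by simp⟩
  | step K T n M k _ hT _ hM ih =>
    obtain ⟨A, B, rfl, ⟨a, ha⟩, b, hb⟩ := ih
    have hM := hM k
    -- if the operator of the other side is zero, the whole branch is zero
    rcases hT with rfl | rfl
    · rw [← mul_assoc, ← localOp_mul] at hM ⊢
      by_cases hb0 : b = 0
      · exact ⟨0, 0, by rw [hzero _ B b hb hb0, localOp_zero, localOp_zero, mul_zero, mul_zero],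
          ⟨0, by simp⟩, 0, by simp⟩
      · exact ⟨_, B, rfl, h _ (.inl rfl) _ (orthogonalImages_of_mul (localOp_commute _ _ _) hb0
          (localOp_conjTranspose_mul_self hb) hM), b, hb⟩
    · rw [(localOp_commute S A B).eq, ← mul_assoc, ← localOp_mul] at hM ⊢
      by_cases ha0 : a = 0
      · exact ⟨0, 0, by rw [hzero _ A a ha ha0, localOp_zero, localOp_zero, mul_zero, mul_zero],
          ⟨0, by simp⟩, 0, by simp⟩
      · exact ⟨A, _, (localOp_commute _ _ _).eq.symm, ⟨a, ha⟩, h _ (.inr rfl) _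
          (orthogonalImages_of_mul (localOp_commute _ _ _).symm ha0
            (localOp_conjTranspose_mul_self ha) hM)⟩

lemma isLocallyIrreducibleAcross_of_forall {S : Finset ι} (hX : ∀ ψ ∈ X, ψ ≠ 0)
    (h : ∀ T, (T = S ∨ T = Sᶜ) → ∀ M, OrthogonalImages X (localOp T M) →
      ∃ c : ℂ, Mᴴ * M = c • 1) : IsLocallyIrreducibleAcross X S := by
  rintro K hK ⟨φ, -, hφ⟩ ψ hψ h0
  obtain ⟨A, B, rfl, ⟨a, ha⟩, b, hb⟩ := hK.exists_eq_mul h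
  have e : (localOp S A * localOp Sᶜ B)ᴴ * (localOp S A * localOp Sᶜ B) = (a * b) • 1 := by
    rw [Matrix.conjTranspose_mul, mul_assoc, ← mul_assoc (localOp S A)ᴴ,
      localOp_conjTranspose_mul_self ha, smul_mul_assoc, one_mul, mul_smul_comm,
      localOp_conjTranspose_mul_self hb, smul_smul]
  have hab : a * b ≠ 0 := fun hab => by
    rw [hab, zero_smul] at e
    exact hφ (by rw [eq_zero_of_conjTranspose_mul_self_eq_zero e, Matrix.zero_mulVec])
  have := congrArg (fun N => N *ᵥ ψ) e
  simp only [← Matrix.mulVec_mulVec, h0, Matrix.mulVec_zero, Matrix.smul_mulVec,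
    Matrix.one_mulVec] at this
  exact hX ψ hψ ((smul_eq_zero.mp this.symm).resolve_left hab)

end Branch

end Hypercube

end

theorem theorem3 (d : Fin 5 → ℕ) (hd : ∀ i, 3 ≤ d i) :
    -- the 32 boxes decompose the outermost layer of the hypercube
    (Pairwise fun k l =>
        Disjoint (Hypercube.blockBox d (Hypercube.block k))
          (Hypercube.blockBox d (Hypercube.block l))) ∧
    (⋃ k, Hypercube.blockBox d (Hypercube.block k)) = Hypercube.outermostLayer d ∧
    -- the states of a block span the same space as the basis vectors in its box
    (∀ k, Submodule.span ℂ (Hypercube.blockStates d (Hypercube.block k)) =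
        Submodule.span ℂ
          ((fun x : Hypercube.Idx d => (Pi.single x 1 : Hypercube.State d)) ''
            Hypercube.blockBox d (Hypercube.block k))) ∧
    Hypercube.IsOrthogonalProductSet (Hypercube.opsFive d) ∧
    Hypercube.IsStrongestNonlocal (Hypercube.opsFive d) ∧
    Hypercube.IsStronglyNonlocal (Hypercube.opsFive d) ∧
    (Hypercube.opsFive d).ncard = ∏ i, d i - ∏ i, (d i - 2) := by
  refine ⟨Hypercube.pairwise_disjoint_blockBox hd, Hypercube.iUnion_blockBox hd,
    fun k => Hypercube.span_blockStates d _, Hypercube.isOrthogonalProductSet_opsFive hd,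
    fun T _ hT n M _ hM k => Hypercube.exists_conjTranspose_mul_self_eq hd hT (hM k),
    fun S hS hS' => ?_, Hypercube.ncard_opsFive hd⟩
  refine Hypercube.isLocallyIrreducibleAcross_of_forall
    (fun ψ hψ => ((Hypercube.isOrthogonalProductSet_opsFive hd).1 ψ hψ).1) ?_
  rintro T (rfl | rfl) M hM
  · exact Hypercube.exists_conjTranspose_mul_self_eq hd hS' hM
  · refine Hypercube.exists_conjTranspose_mul_self_eq hd (fun h => ?_) hM
    exact hS.ne_empty ((Finset.compl_eq_univ_iff S).mp h)
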